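/- \textbf{Setting.} Let $m\ge 1$, let $S\subseteq\mathbb R^n$ be nonempty, closed and convex, let $F_1,\dots,F_m:S\to\mathbb R$ be convex and lower semicontinuous (for instance convex and continuous), and let $\ell>0$. With $\|\cdot\|$ the Euclidean norm, define for $x\in S$ $$u_\ell(x)=\max_{y\in S}\ \min_{i=1,\dots,m}\Big\{F_i(x)-F_i(y)-\tfrac{\ell}{2}\|x-y\|^2\Big\}.$$ For $h:\mathbb R^n\to\mathbb R\cup\{\infty\}$ put $\operatorname{env}_h(x)=\inf_{y\in\mathbb R^n}\{h(y)+\tfrac12\|x-y\|^2\}$ and $\operatorname{prox}_h(x)=\operatorname{argmin}_{y\in\mathbb R^n}\{h(y)+\tfrac12\|x-y\|^2\}$. Let $\iota_S$ be $0$ on $S$ and $\infty$ off $S$, let $\Delta^m=\{\lambda\in\mathbb R^m:\lambda\ge0,\ \sum_i\lambda_i=1\}$, write $p_\lambda(x)=\operatorname{prox}_{\frac1\ell\sum_i\lambda_iF_i+\iota_S}(x)$, and let $$\Lambda(x)=\operatorname*{argmin}_{\lambda\in\Delta^m}\Big\{\sum_{i=1}^m\lambda_iF_i(x)-\ell\,\operatorname{env}_{\frac1\ell\sum_i\lambda_iF_i+\iota_S}(x)\Big\}.$$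 Let $h'(x;d)=\lim_{t\searrow0}\frac{h(x+td)-h(x)}{t}$, a limit in $[-\infty,\infty]$. Call a function $h$ on $S$ \emph{continuously differentiable at the point $x\in S$, with gradient $g$}, if $h(y)-h(z)=g^\top(y-z)+o(\|y-z\|)$ as $y,z\to x$ in $S$. (If $x$ is interior to $S$ this is strict differentiability at $x$; it holds, with $g=\nabla h(x)$, whenever $h$ is $C^1$ near $x$, and it implies that $h$ is differentiable at $x$ and that $\nabla h(y)\to\nabla h(x)$ as $y\to x$ through points where $h$ is differentiable.) \textbf{Theorem.} \begin{enumerate} \item[(0)] For every $x\in S$ the maximum defining $u_\ell(x)$ is attained (so $u_\ell$ is finite), $\Lambda(x)\ne\emptyset$, and $p_\lambda(x)$ exists and is unique for every $\lambda\in\Delta^m$. \item[(1)] Let $x,z\in S$. Each $F_i'(x;z-x)$ exists in $[-\infty,\infty)$. Suppose that either all $F_i'(x;z-x)$ are finite, or some $i$ with $F_i'(x;z-x)=-\infty$ satisfies $\lambda_i>0$ for some $\lambda\in\Lambda(x)$. Then $u_\ell$ has a directional derivative at $x$ in the direction $z-x$, and $$u_\ell'(x;z-x)=\inf_{\lambda\in\Lambda(x)}\Big\{\sum_{i=1}^m\lambda_iF_i'(x;z-x)-\ell\,\big(x-p_\lambda(x)\big)^\top(z-x)\Big\},$$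 with $0\cdot(-\infty)=0$. \item[(2)] Let $x\in S$. If $\Lambda(x)=\{\lambda(x)\}$ is a singleton and each $F_i$ is continuously differentiable at the point $x$ with gradient $g_i$, then $u_\ell$ is continuously differentiable at the point $x$ with gradient $$\sum_{i=1}^m\lambda_i(x)\,g_i-\ell\,\big(x-p_{\lambda(x)}(x)\big).$$ \item[(3)] If $V\subseteq S$ is open in $\mathbb R^n$, each $F_i$ is $C^1$ on $V$, and $\Lambda(x)=\{\lambda(x)\}$ is a singleton for every $x\in V$, then $u_\ell$ is $C^1$ on $V$ and, for every $x\in V$, $$\nabla u_\ell(x)=\sum_{i=1}^m\lambda_i(x)\nabla F_i(x)-\ell\,\big(x-p_{\lambda(x)}(x)\big).$$ \end{enumerate} -/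

import Mathlib

open Filter Topology Asymptotics

noncomputable section

namespace MultiMerit

/-- The `n`-dimensional Euclidean space. -/
abbrev Eu (n : ℕ) : Type := EuclideanSpace ℝ (Fin n)

/-- `h'(x; d) = l`, with `l` an extended real number:
`(h (x + t d) - h x) / t` tends to `l` as `t` decreases to `0`. -/
def HasDirDeriv {n : ℕ} (h : Eu n → ℝ) (x d : Eu n) (l : EReal) : Prop :=
  Tendsto (fun t : ℝ => (((h (x + t • d) - h x) / t : ℝ) : EReal)) (𝓝[>] 0) (𝓝 l)

/-- The directional derivative `h'(x; d)`, as an extended real number; meaningful when the limit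
exists, that is, when `HasDirDeriv h x d (dirDeriv h x d)` holds. -/
def dirDeriv {n : ℕ} (h : Eu n → ℝ) (x d : Eu n) : EReal :=
  limUnder (𝓝[>] 0) (fun t : ℝ => (((h (x + t • d) - h x) / t : ℝ) : EReal))

/-- The function `h`, defined on `S`, is continuously differentiable at the point `x`, relative to
`S` and with gradient `g`, in the pointwise sense:
`h y - h z = ⟨g, y - z⟩ + o(‖y - z‖)` as `y, z → x` in `S`. -/
def HasStrictGradientWithin {n : ℕ} (h : Eu n → ℝ) (S : Set (Eu n)) (g x : Eu n) : Prop :=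
  (fun p : Eu n × Eu n => h p.1 - h p.2 - inner ℝ g (p.1 - p.2))
    =o[𝓝[S ×ˢ S] (x, x)] fun p : Eu n × Eu n => p.1 - p.2

/-- At interior points of `S` this is Mathlib's strict differentiability. -/
theorem hasStrictGradientWithin_iff_of_mem_interior {n : ℕ} {h : Eu n → ℝ} {S : Set (Eu n)}
    {g x : Eu n} (hx : x ∈ interior S) :
    HasStrictGradientWithin h S g x ↔
      HasStrictFDerivAt h (InnerProductSpace.toDual ℝ (Eu n) g) x := by
  have hS : S ×ˢ S ∈ 𝓝 (x, x) :=
    prod_mem_nhds (mem_interior_iff_mem_nhds.1 hx) (mem_interior_iff_mem_nhds.1 hx)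
  rw [hasStrictFDerivAt_iff_isLittleO, HasStrictGradientWithin, nhdsWithin_eq_nhds.2 hS]
  simp only [InnerProductSpace.toDual_apply_apply]

/-- The indicator function of `C`: `0` on `C` and `∞` off `C`. -/
def indicatorFn {n : ℕ} (C : Set (Eu n)) (y : Eu n) : EReal :=
  open Classical in if y ∈ C then 0 else ⊤

/-- The objective `y ↦ h y + (1/2) ‖x - y‖²` of the Moreau envelope. -/
def proxObjective {n : ℕ} (h : Eu n → EReal) (x y : Eu n) : EReal :=
  h y + ((1 / 2 * ‖x - y‖ ^ 2 : ℝ) : EReal)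

/-- The Moreau envelope `env_h (x)`. -/
def moreauEnv {n : ℕ} (h : Eu n → EReal) (x : Eu n) : EReal :=
  ⨅ y : Eu n, proxObjective h x y

/-- `p` minimizes `y ↦ h y + (1/2) ‖x - y‖²` over the whole space. -/
def IsProx {n : ℕ} (h : Eu n → EReal) (x p : Eu n) : Prop :=
  ∀ y : Eu n, proxObjective h x p ≤ proxObjective h x y

/-- The proximal operator: a minimizer of `y ↦ h y + (1/2) ‖x - y‖²`. -/
def prox {n : ℕ} (h : Eu n → EReal) (x : Eu n) : Eu n :=
  Classical.epsilon (IsProx h x)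

/-- The extended-real-valued function `(1/ℓ) ∑ᵢ wᵢ Fᵢ + ι_S`. -/
def scalarized {m n : ℕ} (S : Set (Eu n)) (F : Fin m → Eu n → ℝ) (ℓ : ℝ) (w : Fin m → ℝ)
    (y : Eu n) : EReal :=
  ((1 / ℓ * ∑ i, w i * F i y : ℝ) : EReal) + indicatorFn S y

/-- `min_i { Fᵢ(x) - Fᵢ(y) - (ℓ/2) ‖x - y‖² }` (for `m ≥ 1`). -/
def innerMin {m n : ℕ} (F : Fin m → Eu n → ℝ) (ℓ : ℝ) (x y : Eu n) : ℝ :=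
  ⨅ i, (F i x - F i y - ℓ / 2 * ‖x - y‖ ^ 2)

/-- The regularized merit function
`u_ℓ(x) = max_{y ∈ S} min_i { Fᵢ(x) - Fᵢ(y) - (ℓ/2) ‖x - y‖² }`. -/
def merit {m n : ℕ} (S : Set (Eu n)) (F : Fin m → Eu n → ℝ) (ℓ : ℝ) (x : Eu n) : ℝ :=
  sSup (innerMin F ℓ x '' S)

/-- The dual objective `∑ᵢ wᵢ Fᵢ(x) - ℓ env_{(1/ℓ) ∑ᵢ wᵢ Fᵢ + ι_S}(x)`. -/
def dualObjective {m n : ℕ} (S : Set (Eu n)) (F : Fin m → Eu n → ℝ) (ℓ : ℝ) (x : Eu n)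
    (w : Fin m → ℝ) : EReal :=
  ((∑ i, w i * F i x : ℝ) : EReal) - (ℓ : EReal) * moreauEnv (scalarized S F ℓ w) x

/-- The set `Λ(x)` of minimizers of the dual objective over the standard simplex. -/
def dualSolutions {m n : ℕ} (S : Set (Eu n)) (F : Fin m → Eu n → ℝ) (ℓ : ℝ) (x : Eu n) :
    Set (Fin m → ℝ) :=
  {w | w ∈ stdSimplex ℝ (Fin m) ∧
    ∀ v ∈ stdSimplex ℝ (Fin m), dualObjective S F ℓ x w ≤ dualObjective S F ℓ x v}

end MultiMerit

end

noncomputable section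

namespace MultiMerit

variable {m n : ℕ} {S : Set (Eu n)} {F : Fin m → Eu n → ℝ} {ℓ : ℝ}

/-! ### Proximal points of convex lower semicontinuous functions -/

/-! The proof is Danskin's envelope argument on the dual side. For a weight `w` in the simplex let
φ_w(x), the `dualValue`, be the maximum over `y ∈ S` of the `w`-average of the terms in `innerMin`.
Strong convexity makes the maximizer `proxPt` unique, nonexpansive in `x` and continuous in `w`;
this gives strong duality: the merit function is the minimum of φ_w over the simplex, attained
exactly on Λ (`merit_eq_dualValue`).

Every derivative estimate rests on the inequality `dualValue_sub_le`, which bounds φ_w(y) - φ_w(z)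
from above to first order. A weight optimal at z is only feasible at y, so u(y) - u(z) ≤ φ_w(y) -
φ_w(z). With a fixed weight optimal at `x` this bounds the slopes of the merit function from above;
with weights optimal at the moving point it bounds them from below, once
`eventually_forall_dualSolutions_lt` shows that such weights approach Λ(x). For a singleton Λ(x),
the same estimate on pairs of points near `x` gives strict differentiability, and strict
differentiability throughout an open set gives C¹. -/

theorem norm_convex_combo_sq (x p y : Eu n) (t : ℝ) :
    ‖x - ((1 - t) • p + t • y)‖ ^ 2 =
      (1 - t) * ‖x - p‖ ^ 2 + t * ‖x - y‖ ^ 2 - t * (1 - t) * ‖y - p‖ ^ 2 := by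
  have h1 : x - ((1 - t) • p + t • y) = (1 - t) • (x - p) + t • (x - y) := by module
  have h2 : y - p = (x - p) - (x - y) := by abel
  rw [h1, h2, norm_add_sq_real, norm_sub_sq_real (x - p) (x - y), norm_smul, norm_smul,
    real_inner_smul_left, real_inner_smul_right, mul_pow, mul_pow, Real.norm_eq_abs,
    Real.norm_eq_abs, sq_abs, sq_abs]
  ring

/-- A minimizer of a convex function plus `ℓ/2 ‖x - ·‖²` satisfies a quadratic growth condition. -/
theorem quadratic_growth_of_isMin {h : Eu n → ℝ} (hh : ConvexOn ℝ S h) {x p : Eu n} (hp : p ∈ S)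
    (hmin : ∀ y ∈ S, h p + ℓ / 2 * ‖x - p‖ ^ 2 ≤ h y + ℓ / 2 * ‖x - y‖ ^ 2)
    {y : Eu n} (hy : y ∈ S) :
    h p + ℓ / 2 * ‖x - p‖ ^ 2 + ℓ / 2 * ‖y - p‖ ^ 2 ≤ h y + ℓ / 2 * ‖x - y‖ ^ 2 := by
  -- Compare `p` with a point of the segment to `y`, divide by `t`, and let `t` tend to 0.
  have key : ∀ t ∈ Set.Ioo (0 : ℝ) 1, (1 - t) * (ℓ / 2 * ‖y - p‖ ^ 2) ≤
      (h y + ℓ / 2 * ‖x - y‖ ^ 2) - (h p + ℓ / 2 * ‖x - p‖ ^ 2) := by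
    intro t ht
    have h1 := hmin _ (hh.1 hp hy (by linarith [ht.2] : 0 ≤ 1 - t) ht.1.le (by ring))
    have h2 := hh.2 hp hy (by linarith [ht.2] : 0 ≤ 1 - t) ht.1.le (by ring)
    rw [norm_convex_combo_sq] at h1
    simp only [smul_eq_mul] at h2
    refine le_of_mul_le_mul_left ?_ ht.1
    linarith
  have hlim : Tendsto (fun t : ℝ => (1 - t) * (ℓ / 2 * ‖y - p‖ ^ 2)) (𝓝[>] 0)
      (𝓝 ((1 - 0) * (ℓ / 2 * ‖y - p‖ ^ 2))) :=
    ((by fun_prop : Continuous fun t : ℝ => (1 - t) * (ℓ / 2 * ‖y - p‖ ^ 2)).tendsto 0).mono_left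
      nhdsWithin_le_nhds
  have := le_of_tendsto hlim
    (eventually_of_mem (Ioo_mem_nhdsGT (zero_lt_one' ℝ)) key)
  linarith

/-- A convex lower semicontinuous function decreases at most linearly away from a point. -/
theorem exists_linear_lower_bound {h : Eu n → ℝ} (hS : IsClosed S) (hh : ConvexOn ℝ S h)
    (hlsc : LowerSemicontinuousOn h S) {x₀ : Eu n} (hx₀ : x₀ ∈ S) :
    ∃ C : ℝ, 0 ≤ C ∧ ∀ y ∈ S, 1 ≤ ‖y - x₀‖ → h x₀ - C * ‖y - x₀‖ ≤ h y := by
  have hx₀' : x₀ ∈ S ∩ Metric.closedBall x₀ 1 := ⟨hx₀, Metric.mem_closedBall_self zero_le_one⟩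
  obtain ⟨q, hq, hqmin⟩ := (hlsc.mono Set.inter_subset_left).exists_isMinOn ⟨x₀, hx₀'⟩
    ((isCompact_closedBall x₀ 1).inter_left hS)
  refine ⟨h x₀ - h q, sub_nonneg.2 (hqmin hx₀'), ?_⟩
  intro y hy hr
  set r := ‖y - x₀‖ with hr_def
  have hr0 : 0 < r := by linarith
  have hi : r⁻¹ ≤ 1 := inv_le_one_of_one_le₀ hr
  have hi0 : 0 < r⁻¹ := inv_pos.2 hr0
  -- The point of the segment at distance 1 from `x₀` has value at least `h q`; convexity
  -- extrapolates this bound to `y`.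
  have hmem := hh.1 hx₀ hy (sub_nonneg.2 hi) hi0.le (by ring)
  have hball : (1 - r⁻¹) • x₀ + r⁻¹ • y ∈ Metric.closedBall x₀ 1 := by
    have : (1 - r⁻¹) • x₀ + r⁻¹ • y - x₀ = r⁻¹ • (y - x₀) := by module
    rw [Metric.mem_closedBall, dist_eq_norm, this, norm_smul, Real.norm_of_nonneg hi0.le,
      ← hr_def, inv_mul_cancel₀ hr0.ne']
  have h1 : h q ≤ h ((1 - r⁻¹) • x₀ + r⁻¹ • y) := hqmin ⟨hmem, hball⟩
  have h2 := hh.2 hx₀ hy (sub_nonneg.2 hi) hi0.le (by ring)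
  simp only [smul_eq_mul] at h2
  have h3 : r * h q ≤ r * ((1 - r⁻¹) * h x₀ + r⁻¹ * h y) :=
    mul_le_mul_of_nonneg_left (h1.trans h2) hr0.le
  have h4 : r * ((1 - r⁻¹) * h x₀ + r⁻¹ * h y) = r * h x₀ - h x₀ + h y := by
    field_simp
  linarith

theorem exists_isMin_add_sq {h : Eu n → ℝ} (hS_ne : S.Nonempty) (hS : IsClosed S)
    (hh : ConvexOn ℝ S h) (hlsc : LowerSemicontinuousOn h S) (hℓ : 0 < ℓ) (x : Eu n) :
    ∃ p ∈ S, ∀ y ∈ S, h p + ℓ / 2 * ‖x - p‖ ^ 2 ≤ h y + ℓ / 2 * ‖x - y‖ ^ 2 := by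
  obtain ⟨x₀, hx₀⟩ := hS_ne
  obtain ⟨C, hC, hbound⟩ := exists_linear_lower_bound hS hh hlsc hx₀
  -- With a = ‖x - x₀‖ and r = ‖y - x₀‖ > R, the quadratic gain ℓ/2 ((r - a)² - a²) = ℓ/2 · r (r -
  -- 2a) exceeds the possible loss C r. The 1 puts `y` in the range of `hbound`.
  set R := 1 + 2 * ‖x - x₀‖ + 2 * C / ℓ with hR
  have hR1 : 1 ≤ R := by
    have : 0 ≤ 2 * C / ℓ := by positivity
    linarith [norm_nonneg (x - x₀)]
  have hx₀R : x₀ ∈ S ∩ Metric.closedBall x₀ R :=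
    ⟨hx₀, Metric.mem_closedBall_self (by linarith)⟩
  have hlsc' : LowerSemicontinuousOn (fun y => h y + ℓ / 2 * ‖x - y‖ ^ 2) S :=
    hlsc.add (Continuous.continuousOn (by fun_prop)).lowerSemicontinuousOn
  obtain ⟨p, hp, hmin⟩ := (hlsc'.mono Set.inter_subset_left).exists_isMinOn ⟨x₀, hx₀R⟩
    ((isCompact_closedBall x₀ R).inter_left hS)
  refine ⟨p, hp.1, fun y hy => ?_⟩
  by_cases hyR : ‖y - x₀‖ ≤ R
  · exact hmin ⟨hy, by rwa [Metric.mem_closedBall, dist_eq_norm]⟩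
  push Not at hyR
  refine (hmin hx₀R).trans ?_
  have h1 := hbound y hy (hR1.trans hyR.le)
  have h2 : (‖y - x₀‖ - ‖x - x₀‖) ^ 2 ≤ ‖x - y‖ ^ 2 := by
    rw [sq_le_sq, abs_of_nonneg (norm_nonneg (x - y))]
    have := abs_norm_sub_norm_le (y - x₀) (x - x₀)
    rwa [sub_sub_sub_cancel_right, norm_sub_rev y x] at this
  have h3 : ℓ / 2 * (‖y - x₀‖ - ‖x - x₀‖) ^ 2 ≤ ℓ / 2 * ‖x - y‖ ^ 2 :=
    mul_le_mul_of_nonneg_left h2 (by positivity)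
  have h4 : C ≤ ℓ / 2 * (‖y - x₀‖ - 2 * ‖x - x₀‖) := by
    have : 2 * C / ℓ ≤ ‖y - x₀‖ - 2 * ‖x - x₀‖ := by linarith
    rw [div_le_iff₀ hℓ] at this
    linarith
  have h5 := mul_le_mul_of_nonneg_right h4 (norm_nonneg (y - x₀))
  show h x₀ + ℓ / 2 * ‖x - x₀‖ ^ 2 ≤ _
  nlinarith

/-! ### The scalarized problem -/

/-- The standing assumptions on the feasible set, the objectives and the regularization parameter. -/
structure ConvexData (S : Set (Eu n)) (F : Fin m → Eu n → ℝ) (ℓ : ℝ) : Prop where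
  pos : 1 ≤ m
  nonempty : S.Nonempty
  closed : IsClosed S
  convexOn : ∀ i, ConvexOn ℝ S (F i)
  lsc : ∀ i, LowerSemicontinuousOn (F i) S
  ell_pos : 0 < ℓ

/-- The scalarized objective `∑ᵢ wᵢ Fᵢ(y) + (ℓ/2) ‖x - y‖²`. -/
def scalarObjective (F : Fin m → Eu n → ℝ) (ℓ : ℝ) (w : Fin m → ℝ) (x y : Eu n) : ℝ :=
  ∑ i, w i * F i y + ℓ / 2 * ‖x - y‖ ^ 2

/-- The minimizer of the scalarized objective over `S`. -/
abbrev proxPt (S : Set (Eu n)) (F : Fin m → Eu n → ℝ) (ℓ : ℝ) (w : Fin m → ℝ) (x : Eu n) : Eu n :=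
  prox (scalarized S F ℓ w) x

/-- The dual objective, as a real number. -/
def dualValue (S : Set (Eu n)) (F : Fin m → Eu n → ℝ) (ℓ : ℝ) (w : Fin m → ℝ) (x : Eu n) : ℝ :=
  ∑ i, w i * F i x - scalarObjective F ℓ w x (proxPt S F ℓ w x)

theorem proxObjective_of_mem (hℓ : 0 < ℓ) (w : Fin m → ℝ) (x : Eu n) {y : Eu n} (hy : y ∈ S) :
    proxObjective (scalarized S F ℓ w) x y = ((1 / ℓ * scalarObjective F ℓ w x y : ℝ) : EReal) := by
  rw [proxObjective, scalarized, indicatorFn, if_pos hy, add_zero, ← EReal.coe_add,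
    scalarObjective]
  congr 1
  field_simp

theorem proxObjective_of_notMem (w : Fin m → ℝ) (x : Eu n) {y : Eu n} (hy : y ∉ S) :
    proxObjective (scalarized S F ℓ w) x y = ⊤ := by
  rw [proxObjective, scalarized, indicatorFn, if_neg hy, EReal.coe_add_top, EReal.top_add_coe]

theorem isProx_scalarized_iff (hS : S.Nonempty) (hℓ : 0 < ℓ) (w : Fin m → ℝ) (x p : Eu n) :
    IsProx (scalarized S F ℓ w) x p ↔
      p ∈ S ∧ ∀ y ∈ S, scalarObjective F ℓ w x p ≤ scalarObjective F ℓ w x y := by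
  have hpos : 0 < 1 / ℓ := by positivity
  constructor
  · intro h
    have hp : p ∈ S := by
      by_contra hp
      obtain ⟨y, hy⟩ := hS
      have := h y
      rw [proxObjective_of_notMem w x hp, proxObjective_of_mem hℓ w x hy, top_le_iff] at this
      exact EReal.coe_ne_top _ this
    refine ⟨hp, fun y hy => ?_⟩
    have := h y
    rw [proxObjective_of_mem hℓ w x hp, proxObjective_of_mem hℓ w x hy, EReal.coe_le_coe_iff]
      at this
    exact le_of_mul_le_mul_left this hpos
  · rintro ⟨hp, h⟩ y
    by_cases hy : y ∈ S
    · rw [proxObjective_of_mem hℓ w x hp, proxObjective_of_mem hℓ w x hy, EReal.coe_le_coe_iff]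
      exact mul_le_mul_of_nonneg_left (h y hy) hpos.le
    · rw [proxObjective_of_notMem w x hy]
      exact le_top

theorem scalarObjective_eq_sum {w : Fin m → ℝ} (hw : w ∈ stdSimplex ℝ (Fin m)) (x y : Eu n) :
    scalarObjective F ℓ w x y = ∑ i, w i * (F i y + ℓ / 2 * ‖x - y‖ ^ 2) := by
  simp only [mul_add, Finset.sum_add_distrib, ← Finset.sum_mul, hw.2, one_mul, scalarObjective]

namespace ConvexData

variable (D : ConvexData S F ℓ)
include D

theorem convexOn_sum {w : Fin m → ℝ} (hw : w ∈ stdSimplex ℝ (Fin m)) :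
    ConvexOn ℝ S fun y => ∑ i, w i * F i y := by
  refine ⟨(D.convexOn ⟨0, D.pos⟩).1, fun y hy z hz a b ha hb hab => ?_⟩
  simp only [smul_eq_mul, Finset.mul_sum, ← Finset.sum_add_distrib]
  refine Finset.sum_le_sum fun i _ => ?_
  have := mul_le_mul_of_nonneg_left ((D.convexOn i).2 hy hz ha hb hab) (hw.1 i)
  simp only [smul_eq_mul] at this
  linarith

theorem lsc_sum {w : Fin m → ℝ} (hw : w ∈ stdSimplex ℝ (Fin m)) :
    LowerSemicontinuousOn (fun y => ∑ i, w i * F i y) S :=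
  lowerSemicontinuousOn_sum fun i _ =>
    (continuous_const_mul (w i)).comp_lowerSemicontinuousOn (D.lsc i)
      (monotone_mul_left_of_nonneg (hw.1 i))

theorem isProx_proxPt {w : Fin m → ℝ} (hw : w ∈ stdSimplex ℝ (Fin m)) (x : Eu n) :
    IsProx (scalarized S F ℓ w) x (proxPt S F ℓ w x) := by
  obtain ⟨p, hp, hmin⟩ := exists_isMin_add_sq D.nonempty D.closed (D.convexOn_sum hw)
    (D.lsc_sum hw) D.ell_pos x
  exact Classical.epsilon_spec
    ⟨p, (isProx_scalarized_iff D.nonempty D.ell_pos w x p).2 ⟨hp, hmin⟩⟩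

theorem proxPt_mem {w : Fin m → ℝ} (hw : w ∈ stdSimplex ℝ (Fin m)) (x : Eu n) :
    proxPt S F ℓ w x ∈ S :=
  ((isProx_scalarized_iff D.nonempty D.ell_pos w x _).1 (D.isProx_proxPt hw x)).1

theorem scalarObjective_proxPt_add_le {w : Fin m → ℝ} (hw : w ∈ stdSimplex ℝ (Fin m)) (x : Eu n)
    {y : Eu n} (hy : y ∈ S) :
    scalarObjective F ℓ w x (proxPt S F ℓ w x) + ℓ / 2 * ‖y - proxPt S F ℓ w x‖ ^ 2 ≤
      scalarObjective F ℓ w x y :=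
  quadratic_growth_of_isMin (D.convexOn_sum hw) (D.proxPt_mem hw x)
    ((isProx_scalarized_iff D.nonempty D.ell_pos w x _).1 (D.isProx_proxPt hw x)).2 hy

theorem scalarObjective_proxPt_le {w : Fin m → ℝ} (hw : w ∈ stdSimplex ℝ (Fin m)) (x : Eu n)
    {y : Eu n} (hy : y ∈ S) :
    scalarObjective F ℓ w x (proxPt S F ℓ w x) ≤ scalarObjective F ℓ w x y :=
  ((isProx_scalarized_iff D.nonempty D.ell_pos w x _).1 (D.isProx_proxPt hw x)).2 y hy

theorem isProx_iff {w : Fin m → ℝ} (hw : w ∈ stdSimplex ℝ (Fin m)) (x p : Eu n) :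
    IsProx (scalarized S F ℓ w) x p ↔ p = prox (scalarized S F ℓ w) x := by
  refine ⟨fun h => ?_, fun h => h ▸ D.isProx_proxPt hw x⟩
  obtain ⟨hp, hmin⟩ := (isProx_scalarized_iff D.nonempty D.ell_pos w x p).1 h
  have h1 := D.scalarObjective_proxPt_add_le hw x hp
  have h2 := hmin _ (D.proxPt_mem hw x)
  have h3 : ℓ / 2 * ‖p - proxPt S F ℓ w x‖ ^ 2 ≤ 0 := by linarith
  have hℓ := D.ell_pos
  have h4 : ‖p - proxPt S F ℓ w x‖ ^ 2 ≤ 0 := by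
    by_contra hc
    push Not at hc
    have : 0 < ℓ / 2 * ‖p - proxPt S F ℓ w x‖ ^ 2 := by positivity
    linarith
  have h5 : ‖p - proxPt S F ℓ w x‖ = 0 := by
    simpa using le_antisymm h4 (sq_nonneg _)
  exact sub_eq_zero.1 (norm_eq_zero.1 h5)

theorem dualObjective_eq {w : Fin m → ℝ} (hw : w ∈ stdSimplex ℝ (Fin m)) (x : Eu n) :
    dualObjective S F ℓ x w = (dualValue S F ℓ w x : EReal) := by
  have henv : moreauEnv (scalarized S F ℓ w) x =
      ((1 / ℓ * scalarObjective F ℓ w x (proxPt S F ℓ w x) : ℝ) : EReal) := by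
    rw [← proxObjective_of_mem D.ell_pos w x (D.proxPt_mem hw x)]
    exact le_antisymm (iInf_le _ _) (le_iInf (D.isProx_proxPt hw x))
  have hℓ := D.ell_pos.ne'
  rw [dualObjective, henv, dualValue, ← EReal.coe_mul, ← EReal.coe_sub]
  congr 2
  field_simp

theorem mem_dualSolutions_iff {w : Fin m → ℝ} {x : Eu n} :
    w ∈ dualSolutions S F ℓ x ↔ w ∈ stdSimplex ℝ (Fin m) ∧
      ∀ v ∈ stdSimplex ℝ (Fin m), dualValue S F ℓ w x ≤ dualValue S F ℓ v x := by
  refine and_congr_right fun hw => forall₂_congr fun v hv => ?_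
  rw [D.dualObjective_eq hw, D.dualObjective_eq hv, EReal.coe_le_coe_iff]

/-- The proximal point is nonexpansive in the base point. -/
theorem norm_proxPt_sub_le {w : Fin m → ℝ} (hw : w ∈ stdSimplex ℝ (Fin m)) (x y : Eu n) :
    ‖proxPt S F ℓ w x - proxPt S F ℓ w y‖ ≤ ‖x - y‖ := by
  have h1 := D.scalarObjective_proxPt_add_le hw x (D.proxPt_mem hw y)
  have h2 := D.scalarObjective_proxPt_add_le hw y (D.proxPt_mem hw x)
  set p := proxPt S F ℓ w x
  set q := proxPt S F ℓ w y
  simp only [scalarObjective] at h1 h2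
  rw [norm_sub_rev q p] at h1
  have h3 : ‖x - q‖ ^ 2 - ‖x - p‖ ^ 2 + ‖y - p‖ ^ 2 - ‖y - q‖ ^ 2 = 2 * inner ℝ (x - y) (p - q) := by
    simp only [norm_sub_sq_real, inner_sub_left, inner_sub_right]
    ring
  -- In the sum of the two growth inequalities all values of `F` cancel.
  have h4 : ℓ * ‖p - q‖ ^ 2 ≤ ℓ * inner ℝ (x - y) (p - q) := by linear_combination h1 + h2 + ℓ / 2 * h3
  have h5 := le_of_mul_le_mul_left h4 D.ell_pos
  have h6 := real_inner_le_norm (x - y) (p - q)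
  rcases (norm_nonneg (p - q)).eq_or_lt with h0 | h0
  · rw [← h0]
    exact norm_nonneg _
  · refine le_of_mul_le_mul_right ?_ h0
    nlinarith

/-- After subtracting a common lower bound the summands are nonnegative, so weighted sums can be
compared weight by weight. -/
theorem exists_forall_le (x : Eu n) :
    ∃ B : ℝ, ∀ i, ∀ y ∈ S, B ≤ F i y + ℓ / 2 * ‖x - y‖ ^ 2 := by
  choose p _ hmin using fun i =>
    exists_isMin_add_sq D.nonempty D.closed (D.convexOn i) (D.lsc i) D.ell_pos x
  obtain ⟨B, hB⟩ := (Set.finite_range fun i => F i (p i) + ℓ / 2 * ‖x - p i‖ ^ 2).bddBelow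
  exact ⟨B, fun i y hy => (hB ⟨i, rfl⟩).trans (hmin i y hy)⟩

/-- The proximal point depends continuously on the weights, although the objectives need not be
bounded above near the proximal points. -/
theorem continuousOn_proxPt (x : Eu n) :
    ContinuousOn (fun w => proxPt S F ℓ w x) (stdSimplex ℝ (Fin m)) := by
  intro v hv
  obtain ⟨B, hB⟩ := D.exists_forall_le x
  have hℓ := D.ell_pos
  set q := proxPt S F ℓ v x with hq_def
  have hq := D.proxPt_mem hv x
  set A := scalarObjective F ℓ v x q - B with hA_def
  have hA : 0 ≤ A := by
    rw [hA_def, scalarObjective_eq_sum hv, sub_nonneg]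
    calc B = ∑ i, v i * B := by rw [← Finset.sum_mul, hv.2, one_mul]
      _ ≤ _ := Finset.sum_le_sum fun i _ => mul_le_mul_of_nonneg_left (hB i q hq) (hv.1 i)
  rw [ContinuousWithinAt, tendsto_iff_norm_sub_tendsto_zero]
  suffices hsq : Tendsto (fun w => ‖proxPt S F ℓ w x - q‖ ^ 2) (𝓝[stdSimplex ℝ (Fin m)] v) (𝓝 0) by
    simpa using hsq.sqrt
  refine Metric.tendsto_nhds.2 fun ε hε => ?_
  -- `s` is so close to 1 that the loss (1 - s) A stays below the growth at distance √ε. For large ε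
  -- it may be negative, hence the case split in `h2`.
  obtain ⟨s, hs1, hs⟩ : ∃ s : ℝ, s < 1 ∧ (1 - s) * A < ℓ / 2 * ε := by
    refine ⟨1 - ℓ / 2 * ε / (A + 1), by
      have : 0 < ℓ / 2 * ε / (A + 1) := by positivity
      linarith, ?_⟩
    have h1 : 0 < ℓ / 2 * ε := by positivity
    rw [sub_sub_cancel, div_mul_eq_mul_div, div_lt_iff₀ (by positivity)]
    nlinarith
  -- The domination s v ≤ w replaces an upper bound on the objectives at the moving proximal point,
  -- which is not available.
  have hev1 : ∀ᶠ w in 𝓝[stdSimplex ℝ (Fin m)] v, ∀ i, s * v i ≤ w i := by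
    rw [eventually_all]
    intro i
    rcases (hv.1 i).eq_or_lt with h0 | h0
    · filter_upwards [self_mem_nhdsWithin] with w hw
      rw [← h0, mul_zero]
      exact hw.1 i
    · have : s * v i < v i := by nlinarith
      exact (((continuous_apply i).tendsto v).mono_left nhdsWithin_le_nhds).eventually
        (lt_mem_nhds this) |>.mono fun w hw => hw.le
  have hcont : Tendsto (fun w : Fin m → ℝ => scalarObjective F ℓ w x q - B - s * A)
      (𝓝[stdSimplex ℝ (Fin m)] v) (𝓝 (scalarObjective F ℓ v x q - B - s * A)) :=
    ((by unfold scalarObjective; fun_prop : Continuous fun w : Fin m → ℝ =>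
      scalarObjective F ℓ w x q - B - s * A).tendsto v).mono_left nhdsWithin_le_nhds
  have hev2 := hcont.eventually (gt_mem_nhds (by
    rw [← hA_def]
    linarith : scalarObjective F ℓ v x q - B - s * A < ℓ / 2 * ε))
  filter_upwards [hev1, hev2, self_mem_nhdsWithin] with w hw1 hw2 hw
  rw [Real.dist_eq, sub_zero, abs_of_nonneg (sq_nonneg _)]
  set p := proxPt S F ℓ w x with hp_def
  have hp := D.proxPt_mem hw x
  have h1 := D.scalarObjective_proxPt_add_le hw x hq
  rw [← hp_def, norm_sub_rev] at h1
  have h2 : s * A ≤ scalarObjective F ℓ w x p - B := by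
    have h3 : ∀ u ∈ stdSimplex ℝ (Fin m), scalarObjective F ℓ u x p - B =
        ∑ i, u i * (F i p + ℓ / 2 * ‖x - p‖ ^ 2 - B) := by
      intro u hu
      simp only [scalarObjective_eq_sum hu, mul_sub, Finset.sum_sub_distrib, ← Finset.sum_mul,
        hu.2, one_mul]
    have h4 : s * (scalarObjective F ℓ v x p - B) ≤ scalarObjective F ℓ w x p - B := by
      rw [h3 v hv, h3 w hw, Finset.mul_sum]
      refine Finset.sum_le_sum fun i _ => ?_
      rw [← mul_assoc]
      exact mul_le_mul_of_nonneg_right (hw1 i) (sub_nonneg.2 (hB i p hp))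
    by_cases hs0 : 0 ≤ s
    · refine le_trans (mul_le_mul_of_nonneg_left ?_ hs0) h4
      exact sub_le_sub_right (D.scalarObjective_proxPt_le hv x hp) B
    · have h5 : 0 ≤ scalarObjective F ℓ w x p - B := by
        rw [h3 w hw]
        exact Finset.sum_nonneg fun i _ => mul_nonneg (hw.1 i) (sub_nonneg.2 (hB i p hp))
      nlinarith
  have h6 : ℓ / 2 * ‖p - q‖ ^ 2 < ℓ / 2 * ε := by linarith
  exact lt_of_mul_lt_mul_left h6 (by positivity)

end ConvexData

/-! ### Duality -/

theorem innerMin_le (F : Fin m → Eu n → ℝ) (ℓ : ℝ) (x y : Eu n) (i : Fin m) :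
    innerMin F ℓ x y ≤ F i x - F i y - ℓ / 2 * ‖x - y‖ ^ 2 :=
  ciInf_le (Set.finite_range _).bddBelow i

theorem innerMin_le_sum (F : Fin m → Eu n → ℝ) (ℓ : ℝ) {w : Fin m → ℝ}
    (hw : w ∈ stdSimplex ℝ (Fin m)) (x y : Eu n) :
    innerMin F ℓ x y ≤ ∑ i, w i * F i x - scalarObjective F ℓ w x y := by
  calc innerMin F ℓ x y = ∑ i, w i * innerMin F ℓ x y := by
        rw [← Finset.sum_mul, hw.2, one_mul]
    _ ≤ ∑ i, w i * (F i x - F i y - ℓ / 2 * ‖x - y‖ ^ 2) :=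
        Finset.sum_le_sum fun i _ => mul_le_mul_of_nonneg_left (innerMin_le F ℓ x y i) (hw.1 i)
    _ = _ := by
        simp only [scalarObjective, mul_sub, Finset.sum_sub_distrib, ← Finset.sum_mul, hw.2,
          one_mul]
        ring

theorem continuous_sum_sub_scalarObjective (F : Fin m → Eu n → ℝ) (ℓ : ℝ) (x y : Eu n) :
    Continuous fun w : Fin m → ℝ => ∑ i, w i * F i x - scalarObjective F ℓ w x y := by
  unfold scalarObjective
  fun_prop

namespace ConvexData

variable (D : ConvexData S F ℓ)
include D

theorem le_dualValue {w : Fin m → ℝ} (hw : w ∈ stdSimplex ℝ (Fin m)) (x : Eu n) {y : Eu n}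
    (hy : y ∈ S) : ∑ i, w i * F i x - scalarObjective F ℓ w x y ≤ dualValue S F ℓ w x :=
  sub_le_sub_left (D.scalarObjective_proxPt_le hw x hy) _

/-- The dual value is a supremum over `y ∈ S` of functions affine in the weight. -/
theorem lowerSemicontinuousOn_dualValue (x : Eu n) :
    LowerSemicontinuousOn (fun w => dualValue S F ℓ w x) (stdSimplex ℝ (Fin m)) := by
  intro w hw a ha
  have h := ((continuous_sum_sub_scalarObjective F ℓ x (proxPt S F ℓ w x)).tendsto w).mono_left
    (nhdsWithin_le_nhds (s := stdSimplex ℝ (Fin m)))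
  filter_upwards [h.eventually (lt_mem_nhds ha), self_mem_nhdsWithin] with v hv hvs
  exact hv.trans_le (D.le_dualValue hvs x (D.proxPt_mem hw x))

theorem dualSolutions_nonempty (x : Eu n) : (dualSolutions S F ℓ x).Nonempty := by
  obtain ⟨w, hw, hmin⟩ := (D.lowerSemicontinuousOn_dualValue x).exists_isMinOn
    ⟨_, single_mem_stdSimplex ℝ (⟨0, D.pos⟩ : Fin m)⟩ (isCompact_stdSimplex ℝ (Fin m))
  exact ⟨w, D.mem_dualSolutions_iff.2 ⟨hw, fun v hv => hmin hv⟩⟩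

/-- The proximal point of a dual solution attains the dual value in the primal problem. -/
theorem dualValue_le_innerMin {w : Fin m → ℝ} {x : Eu n} (hw : w ∈ dualSolutions S F ℓ x) :
    dualValue S F ℓ w x ≤ innerMin F ℓ x (proxPt S F ℓ w x) := by
  obtain ⟨hws, hmin⟩ := D.mem_dualSolutions_iff.1 hw
  have : Nonempty (Fin m) := ⟨⟨0, D.pos⟩⟩
  refine le_ciInf fun i => ?_
  -- No minimax theorem is needed: perturbing `w` towards the vertex `e` and using its optimality
  -- isolates the `i`-th term.
  set e : Fin m → ℝ := Pi.single i 1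
  have he : e ∈ stdSimplex ℝ (Fin m) := single_mem_stdSimplex ℝ i
  let v : ℝ → Fin m → ℝ := fun t => (1 - t) • w + t • e
  have hv : ∀ t ∈ Set.Ioo (0 : ℝ) 1, v t ∈ stdSimplex ℝ (Fin m) := fun t ht =>
    convex_stdSimplex ℝ (Fin m) hws he (by linarith [ht.2]) ht.1.le (by ring)
  have hIoo : Set.Ioo (0 : ℝ) 1 ∈ 𝓝[>] (0 : ℝ) := Ioo_mem_nhdsGT one_pos
  have hle : ∀ t ∈ Set.Ioo (0 : ℝ) 1, F i (proxPt S F ℓ (v t) x) ≤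
      F i x - ℓ / 2 * ‖x - proxPt S F ℓ (v t) x‖ ^ 2 - dualValue S F ℓ w x := by
    intro t ht
    set p := proxPt S F ℓ (v t) x with hp
    have h1 := hmin _ (hv t ht)
    have h2 := D.le_dualValue hws x (D.proxPt_mem (hv t ht) x)
    have h3 : dualValue S F ℓ (v t) x =
        (1 - t) * (∑ j, w j * F j x - scalarObjective F ℓ w x p) +
          t * (F i x - F i p - ℓ / 2 * ‖x - p‖ ^ 2) := by
      have h4 : ∀ y, ∑ j, v t j * F j y = (1 - t) * ∑ j, w j * F j y + t * F i y := by
        intro y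
        simp [v, e, add_mul, Finset.sum_add_distrib, mul_assoc, Finset.mul_sum,
          Pi.single_apply]
      rw [dualValue, ← hp, scalarObjective, scalarObjective, h4, h4]
      ring
    rw [← hp] at h2
    -- The `w`-part is at most the optimal value, and the whole is at least that value, so the
    -- `i`-th part must be too.
    have h5 : (1 - t) * (∑ j, w j * F j x - scalarObjective F ℓ w x p) ≤
        (1 - t) * dualValue S F ℓ w x := mul_le_mul_of_nonneg_left h2 (by linarith [ht.2])
    have h6 : t * dualValue S F ℓ w x ≤ t * (F i x - F i p - ℓ / 2 * ‖x - p‖ ^ 2) := by linarith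
    linarith [le_of_mul_le_mul_left h6 ht.1]
  have hvtend : Tendsto v (𝓝[>] 0) (𝓝[stdSimplex ℝ (Fin m)] w) := by
    refine tendsto_nhdsWithin_iff.2 ⟨?_, eventually_of_mem hIoo hv⟩
    have : Continuous v := by fun_prop
    simpa [v] using (this.tendsto 0).mono_left (nhdsWithin_le_nhds (s := Set.Ioi (0 : ℝ)))
  have hptend : Tendsto (fun t => proxPt S F ℓ (v t) x) (𝓝[>] 0) (𝓝[S] (proxPt S F ℓ w x)) :=
    tendsto_nhdsWithin_iff.2 ⟨(D.continuousOn_proxPt x w hws).tendsto.comp hvtend,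
      eventually_of_mem hIoo fun t ht => D.proxPt_mem (hv t ht) x⟩
  have hrhs : Tendsto (fun t => F i x - ℓ / 2 * ‖x - proxPt S F ℓ (v t) x‖ ^ 2 -
      dualValue S F ℓ w x) (𝓝[>] 0)
      (𝓝 (F i x - ℓ / 2 * ‖x - proxPt S F ℓ w x‖ ^ 2 - dualValue S F ℓ w x)) :=
    ((by fun_prop : Continuous fun y : Eu n => F i x - ℓ / 2 * ‖x - y‖ ^ 2 -
      dualValue S F ℓ w x).tendsto _).comp (hptend.mono_right nhdsWithin_le_nhds)
  -- Lower semicontinuity of `F i` suffices, since `F i` is bounded above along the approach.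
  have hlim : F i (proxPt S F ℓ w x) ≤
      F i x - ℓ / 2 * ‖x - proxPt S F ℓ w x‖ ^ 2 - dualValue S F ℓ w x := by
    refine le_of_forall_lt fun a ha => ?_
    obtain ⟨b, hab, hb⟩ := exists_between ha
    refine hab.trans_le (ge_of_tendsto hrhs ?_)
    filter_upwards [hptend.eventually (D.lsc i _ (D.proxPt_mem hws x) b hb), hIoo] with t ht1 ht2
    exact ht1.le.trans (hle t ht2)
  linarith

theorem isGreatest_dualValue {w : Fin m → ℝ} {x : Eu n} (hw : w ∈ dualSolutions S F ℓ x) :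
    IsGreatest (innerMin F ℓ x '' S) (dualValue S F ℓ w x) := by
  have hws := (D.mem_dualSolutions_iff.1 hw).1
  have hle : ∀ y ∈ S, innerMin F ℓ x y ≤ dualValue S F ℓ w x := fun y hy =>
    (innerMin_le_sum F ℓ hws x y).trans (D.le_dualValue hws x hy)
  refine ⟨⟨_, D.proxPt_mem hws x, le_antisymm (hle _ (D.proxPt_mem hws x))
    (D.dualValue_le_innerMin hw)⟩, ?_⟩
  rintro _ ⟨y, hy, rfl⟩
  exact hle y hy

/-- Strong duality: the merit function is the optimal dual value. -/
theorem merit_eq_dualValue {w : Fin m → ℝ} {x : Eu n} (hw : w ∈ dualSolutions S F ℓ x) :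
    merit S F ℓ x = dualValue S F ℓ w x :=
  (D.isGreatest_dualValue hw).csSup_eq

theorem merit_le_dualValue {w : Fin m → ℝ} (hw : w ∈ stdSimplex ℝ (Fin m)) (x : Eu n) :
    merit S F ℓ x ≤ dualValue S F ℓ w x := by
  obtain ⟨v, hv⟩ := D.dualSolutions_nonempty x
  rw [D.merit_eq_dualValue hv]
  exact (D.mem_dualSolutions_iff.1 hv).2 w hw

theorem isGreatest_merit (x : Eu n) : IsGreatest (innerMin F ℓ x '' S) (merit S F ℓ x) := by
  obtain ⟨v, hv⟩ := D.dualSolutions_nonempty x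
  rw [D.merit_eq_dualValue hv]
  exact D.isGreatest_dualValue hv

theorem mem_dualSolutions_iff_le_merit {w : Fin m → ℝ} {x : Eu n} :
    w ∈ dualSolutions S F ℓ x ↔ w ∈ stdSimplex ℝ (Fin m) ∧
      dualValue S F ℓ w x ≤ merit S F ℓ x := by
  refine ⟨fun hw => ⟨hw.1, (D.merit_eq_dualValue hw).ge⟩, fun hw =>
    D.mem_dualSolutions_iff.2 ⟨hw.1, fun v hv => hw.2.trans (D.merit_le_dualValue hv x)⟩⟩

/-! ### Variation of the base point -/

/-- The proximal point of `y` is a competitor in the problem at `z`; the objective values at that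
point cancel, and expanding the square leaves the linear term. -/
theorem dualValue_sub_le {w : Fin m → ℝ} (hw : w ∈ stdSimplex ℝ (Fin m)) (y z : Eu n) :
    dualValue S F ℓ w y - dualValue S F ℓ w z ≤ ∑ i, w i * (F i y - F i z) -
      ℓ * inner ℝ (y - proxPt S F ℓ w y) (y - z) + ℓ / 2 * ‖y - z‖ ^ 2 := by
  have h1 := D.le_dualValue hw z (D.proxPt_mem hw y)
  set p := proxPt S F ℓ w y with hp
  have h2 : ‖z - p‖ ^ 2 = ‖y - p‖ ^ 2 - 2 * inner ℝ (y - p) (y - z) + ‖y - z‖ ^ 2 := by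
    rw [← norm_sub_sq_real, sub_sub_sub_cancel_left]
  rw [dualValue, ← hp]
  simp only [scalarObjective, mul_sub, Finset.sum_sub_distrib] at h1 ⊢
  linear_combination h1 + ℓ / 2 * h2

theorem exists_norm_sub_proxPt_le (x : Eu n) :
    ∃ M : ℝ, ∀ w ∈ stdSimplex ℝ (Fin m), ‖x - proxPt S F ℓ w x‖ ≤ M :=
  (isCompact_stdSimplex ℝ (Fin m)).exists_bound_of_continuousOn
    (continuousOn_const.sub (D.continuousOn_proxPt x))

/-- Strict upper bounds that hold on the dual solutions hold for all nearly optimal weights. -/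
theorem exists_pos_forall_lt {r : (Fin m → ℝ) → ℝ} {b : ℝ} {x : Eu n}
    (hr : ContinuousOn r (stdSimplex ℝ (Fin m))) (hb : ∀ w ∈ dualSolutions S F ℓ x, r w < b) :
    ∃ δ > 0, ∀ w ∈ stdSimplex ℝ (Fin m), dualValue S F ℓ w x < merit S F ℓ x + δ → r w < b := by
  set K := stdSimplex ℝ (Fin m) ∩ r ⁻¹' Set.Ici b with hK
  have hKc : IsCompact K := (isCompact_stdSimplex ℝ (Fin m)).of_isClosed_subset
    (hr.preimage_isClosed_of_isClosed (isClosed_stdSimplex ℝ (Fin m)) isClosed_Ici)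
    Set.inter_subset_left
  rcases K.eq_empty_or_nonempty with h0 | hne
  · refine ⟨1, one_pos, fun w hw _ => ?_⟩
    by_contra hc
    have : w ∈ K := ⟨hw, not_lt.1 hc⟩
    rw [h0] at this
    exact this
  · obtain ⟨v, hv, hmin⟩ :=
      ((D.lowerSemicontinuousOn_dualValue x).mono Set.inter_subset_left).exists_isMinOn hne hKc
    -- `K` collects the weights violating the bound. None is optimal, so the least dual value on `K`
    -- exceeds the merit value by a positive gap.
    refine ⟨dualValue S F ℓ v x - merit S F ℓ x, ?_, fun w hw hlt => ?_⟩
    · by_contra hc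
      have : v ∈ dualSolutions S F ℓ x :=
        D.mem_dualSolutions_iff_le_merit.2 ⟨hv.1, by linarith⟩
      exact absurd (hb v this) (not_lt.2 hv.2)
    · by_contra hc
      have : dualValue S F ℓ v x ≤ dualValue S F ℓ w x := hmin ⟨hw, not_lt.1 hc⟩
      linarith

/-- Stability of the dual solutions. -/
theorem eventually_forall_dualSolutions_lt {α : Type*} {L : Filter α} {xs : α → Eu n} {x : Eu n}
    (hxs : Tendsto xs L (𝓝 x)) (hF : ∀ i, Tendsto (fun a => F i (xs a)) L (𝓝 (F i x)))
    {r : (Fin m → ℝ) → ℝ} {b : ℝ} (hr : ContinuousOn r (stdSimplex ℝ (Fin m)))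
    (hb : ∀ w ∈ dualSolutions S F ℓ x, r w < b) :
    ∀ᶠ a in L, ∀ w ∈ dualSolutions S F ℓ (xs a), r w < b := by
  obtain ⟨δ, hδ, hlt⟩ := D.exists_pos_forall_lt hr hb
  obtain ⟨M, hM⟩ := D.exists_norm_sub_proxPt_le x
  obtain ⟨v, hv⟩ := D.dualSolutions_nonempty x
  have hℓ := D.ell_pos
  have hs : Tendsto (fun a => ‖xs a - x‖) L (𝓝 0) := tendsto_iff_norm_sub_tendsto_zero.1 hxs
  have hG : Tendsto (fun a => ∑ i, |F i (xs a) - F i x|) L (𝓝 0) := by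
    simpa using tendsto_finsetSum Finset.univ fun i _ =>
      ((hF i).sub_const (F i x)).abs
  -- This is the total error in φ_w(x) ≈ φ_w(xs a) = u(xs a) ≤ φ_v(xs a) ≈ φ_v(x) = u(x), with `w`
  -- optimal at `xs a` and `v` at `x`: `dualValue_sub_le` is used twice.
  have herr : Tendsto (fun a => 2 * ∑ i, |F i (xs a) - F i x| +
      ℓ * (2 * M + 2 * ‖xs a - x‖) * ‖xs a - x‖ + ℓ * ‖xs a - x‖ ^ 2) L (𝓝 0) := by
    simpa using ((hG.const_mul 2).add (((hs.const_mul 2).const_add (2 * M)).const_mul ℓ |>.mul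
      hs)).add ((hs.pow 2).const_mul ℓ)
  filter_upwards [herr.eventually (gt_mem_nhds hδ)] with a ha w hw
  refine hlt w hw.1 ?_
  have hsum : ∀ u ∈ stdSimplex ℝ (Fin m), ∀ c : Fin m → ℝ, ∑ i, u i * c i ≤ ∑ i, |c i| :=
    fun u hu c => Finset.sum_le_sum fun i _ => (mul_le_mul_of_nonneg_left (le_abs_self _)
      (hu.1 i)).trans (mul_le_of_le_one_left (abs_nonneg _) (mem_Icc_of_mem_stdSimplex hu i).2)
  have h1 := D.dualValue_sub_le hw.1 x (xs a)
  have h2 := D.dualValue_sub_le hv.1 (xs a) x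
  have h3 := D.merit_eq_dualValue hw
  have h4 := D.merit_eq_dualValue hv
  have h5 := D.merit_le_dualValue hv.1 (xs a)
  have h6 := hsum w hw.1 fun i => F i x - F i (xs a)
  have h7 := hsum v hv.1 fun i => F i (xs a) - F i x
  simp only [abs_sub_comm (F _ x)] at h6
  have h8 : -(M * ‖xs a - x‖) ≤ inner ℝ (x - proxPt S F ℓ w x) (x - xs a) := by
    refine neg_le_of_neg_le ((neg_le_abs _).trans ((abs_real_inner_le_norm _ _).trans ?_))
    rw [norm_sub_rev x (xs a)]
    exact mul_le_mul_of_nonneg_right (hM w hw.1) (norm_nonneg _)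
  have h9 : -((M + 2 * ‖xs a - x‖) * ‖xs a - x‖) ≤
      inner ℝ (xs a - proxPt S F ℓ v (xs a)) (xs a - x) := by
    refine neg_le_of_neg_le ((neg_le_abs _).trans ((abs_real_inner_le_norm _ _).trans ?_))
    refine mul_le_mul_of_nonneg_right ?_ (norm_nonneg _)
    have e : xs a - proxPt S F ℓ v (xs a) = (x - proxPt S F ℓ v x) + (xs a - x) -
      (proxPt S F ℓ v (xs a) - proxPt S F ℓ v x) := by abel
    rw [e]
    refine (norm_sub_le _ _).trans ((add_le_add_left (norm_add_le _ _) _).trans ?_)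
    linarith [hM v hv.1, D.norm_proxPt_sub_le hv.1 (xs a) x]
  rw [norm_sub_rev x (xs a)] at h1
  have h10 := mul_le_mul_of_nonneg_left h8 hℓ.le
  have h11 := mul_le_mul_of_nonneg_left h9 hℓ.le
  linarith

end ConvexData

/-! ### One-sided directional derivatives of convex functions -/

theorem segment_eq (x z : Eu n) (t : ℝ) : x + t • (z - x) = (1 - t) • x + t • z := by
  module

theorem segment_mem (hS : Convex ℝ S) {x z : Eu n} (hx : x ∈ S) (hz : z ∈ S) {t : ℝ}
    (ht : t ∈ Set.Ioo (0 : ℝ) 1) : x + t • (z - x) ∈ S :=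
  segment_eq x z t ▸ hS hx hz (by linarith [ht.2]) ht.1.le (by ring)

theorem tendsto_segment (x d : Eu n) :
    Tendsto (fun t : ℝ => x + t • d) (𝓝[>] 0) (𝓝 x) := by
  have h : Continuous fun t : ℝ => x + t • d := by fun_prop
  simpa using (h.tendsto 0).mono_left (nhdsWithin_le_nhds (s := Set.Ioi (0 : ℝ)))

theorem monotoneOn_slope {h : Eu n → ℝ} (hh : ConvexOn ℝ S h) {x z : Eu n} (hx : x ∈ S)
    (hz : z ∈ S) : MonotoneOn (fun t : ℝ => (((h (x + t • (z - x)) - h x) / t : ℝ) : EReal))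
      (Set.Ioo 0 1) := by
  intro s hs t ht hst
  rw [EReal.coe_le_coe_iff, div_le_div_iff₀ hs.1 ht.1]
  have hr : s / t ≤ 1 := (div_le_one ht.1).2 hst
  have hr0 : 0 ≤ s / t := (div_pos hs.1 ht.1).le
  have h1 := hh.2 hx (segment_mem hh.1 hx hz ht) (sub_nonneg.2 hr) hr0 (by ring)
  rw [← segment_eq, add_sub_cancel_left, smul_smul, div_mul_cancel₀ _ ht.1.ne'] at h1
  simp only [smul_eq_mul] at h1
  have h2 := mul_le_mul_of_nonneg_left h1 ht.1.le
  have h3 : t * ((1 - s / t) * h x + s / t * h (x + t • (z - x))) =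
      (t - s) * h x + s * h (x + t • (z - x)) := by
    have := ht.1.ne'
    field_simp
  linarith

theorem hasDirDeriv_sInf {h : Eu n → ℝ} (hh : ConvexOn ℝ S h) {x z : Eu n} (hx : x ∈ S)
    (hz : z ∈ S) : HasDirDeriv h x (z - x)
      (sInf ((fun t : ℝ => (((h (x + t • (z - x)) - h x) / t : ℝ) : EReal)) '' Set.Ioo 0 1)) :=
  (monotoneOn_slope hh hx hz).tendsto_nhdsWithin_Ioo_right (Set.nonempty_Ioo.2 one_pos)
    (OrderBot.bddBelow _)

theorem hasDirDeriv_dirDeriv {h : Eu n → ℝ} (hh : ConvexOn ℝ S h) {x z : Eu n} (hx : x ∈ S)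
    (hz : z ∈ S) : HasDirDeriv h x (z - x) (dirDeriv h x (z - x)) :=
  tendsto_nhds_limUnder ⟨_, hasDirDeriv_sInf hh hx hz⟩

theorem dirDeriv_le_slope {h : Eu n → ℝ} (hh : ConvexOn ℝ S h) {x z : Eu n} (hx : x ∈ S)
    (hz : z ∈ S) {t : ℝ} (ht : t ∈ Set.Ioo (0 : ℝ) 1) :
    dirDeriv h x (z - x) ≤ (((h (x + t • (z - x)) - h x) / t : ℝ) : EReal) := by
  rw [tendsto_nhds_unique (hasDirDeriv_dirDeriv hh hx hz) (hasDirDeriv_sInf hh hx hz)]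
  exact sInf_le ⟨t, ht, rfl⟩

theorem dirDeriv_ne_top {h : Eu n → ℝ} (hh : ConvexOn ℝ S h) {x z : Eu n} (hx : x ∈ S)
    (hz : z ∈ S) : dirDeriv h x (z - x) ≠ ⊤ :=
  ((dirDeriv_le_slope hh hx hz (t := 1 / 2) (by norm_num)).trans_lt (EReal.coe_lt_top _)).ne

/-- Lower semicontinuity gives the lower half and the chord the upper half, so continuity along
segments needs no continuity on `S`. -/
theorem tendsto_comp_segment {h : Eu n → ℝ} (hh : ConvexOn ℝ S h)
    (hlsc : LowerSemicontinuousOn h S) {x z : Eu n} (hx : x ∈ S) (hz : z ∈ S) :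
    Tendsto (fun t : ℝ => h (x + t • (z - x))) (𝓝[>] 0) (𝓝 (h x)) := by
  have hIoo : Set.Ioo (0 : ℝ) 1 ∈ 𝓝[>] (0 : ℝ) := Ioo_mem_nhdsGT one_pos
  have hseg : Tendsto (fun t : ℝ => x + t • (z - x)) (𝓝[>] 0) (𝓝[S] x) :=
    tendsto_nhdsWithin_iff.2 ⟨tendsto_segment x _,
      eventually_of_mem hIoo fun t ht => segment_mem hh.1 hx hz ht⟩
  refine tendsto_order.2 ⟨fun a ha => hseg.eventually (hlsc x hx a ha), fun a ha => ?_⟩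
  have hc : Continuous fun t : ℝ => (1 - t) * h x + t * h z := by fun_prop
  have hlim : Tendsto (fun t : ℝ => (1 - t) * h x + t * h z) (𝓝[>] 0) (𝓝 (h x)) := by
    simpa using (hc.tendsto 0).mono_left (nhdsWithin_le_nhds (s := Set.Ioi (0 : ℝ)))
  filter_upwards [hlim.eventually (gt_mem_nhds ha), hIoo] with t hta ht
  refine lt_of_le_of_lt ?_ hta
  rw [segment_eq]
  exact hh.2 hx hz (by linarith [ht.2]) ht.1.le (by ring)

/-! ### Sums of extended real numbers -/

theorem ereal_coe_sum {ι : Type*} (s : Finset ι) (a : ι → ℝ) :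
    ((∑ i ∈ s, a i : ℝ) : EReal) = ∑ i ∈ s, (a i : EReal) := by
  classical
  induction s using Finset.induction_on with
  | empty => simp
  | insert i s hi ih => rw [Finset.sum_insert hi, Finset.sum_insert hi, EReal.coe_add, ih]

/-- Addition of extended reals is discontinuous only at ⊤ + ⊥, so finiteness from above is carried
through the induction. -/
theorem tendsto_ereal_sum {α ι : Type*} {l : Filter α} (s : Finset ι) {a : ι → α → EReal}
    {b : ι → EReal} (h : ∀ i, Tendsto (a i) l (𝓝 (b i))) (hb : ∀ i, b i ≠ ⊤) :
    Tendsto (fun t => ∑ i ∈ s, a i t) l (𝓝 (∑ i ∈ s, b i)) ∧ ∑ i ∈ s, b i ≠ ⊤ := by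
  classical
  induction s using Finset.induction_on with
  | empty => simp [tendsto_const_nhds]
  | insert i s hi ih =>
    simp only [Finset.sum_insert hi]
    exact ⟨(EReal.continuousAt_add (.inl (hb i)) (.inr ih.2)).tendsto.comp
      ((h i).prodMk_nhds ih.1), EReal.add_ne_top (hb i) ih.2⟩

theorem coe_mul_ne_top_of_ne_top {c : ℝ} (hc : 0 ≤ c) {b : EReal} (hb : b ≠ ⊤) :
    (c : EReal) * b ≠ ⊤ := by
  rcases hc.eq_or_lt with rfl | hc
  · simp
  · induction b with
    | bot => simp [EReal.coe_mul_bot_of_pos hc]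
    | coe b =>
      rw [← EReal.coe_mul]
      exact EReal.coe_ne_top _
    | top => exact absurd rfl hb

namespace ConvexData

variable (D : ConvexData S F ℓ)
include D

/-! ### Directional differentiability of the merit function -/

theorem continuous_proxPt {w : Fin m → ℝ} (hw : w ∈ stdSimplex ℝ (Fin m)) :
    Continuous (proxPt S F ℓ w) :=
  (LipschitzWith.mk_one fun x y => by
    simpa only [dist_eq_norm] using D.norm_proxPt_sub_le hw x y).continuous

/-- Upper half of the formula: a weight optimal at `x` is kept fixed while the base point moves. -/
theorem eventually_slope_merit_lt {x z : Eu n} (hx : x ∈ S) (hz : z ∈ S) {w : Fin m → ℝ}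
    (hw : w ∈ dualSolutions S F ℓ x) {a : EReal}
    (ha : (∑ i, (w i : EReal) * dirDeriv (F i) x (z - x)) -
      ((ℓ * inner ℝ (x - proxPt S F ℓ w x) (z - x) : ℝ) : EReal) < a) :
    ∀ᶠ t : ℝ in 𝓝[>] 0,
      (((merit S F ℓ (x + t • (z - x)) - merit S F ℓ x) / t : ℝ) : EReal) < a := by
  set d := z - x
  have hws := hw.1
  let e : ℝ → ℝ := fun t =>
    -(ℓ * inner ℝ (x + t • d - proxPt S F ℓ w (x + t • d)) d) + ℓ / 2 * t * ‖d‖ ^ 2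
  have he : Tendsto e (𝓝[>] 0) (𝓝 (-(ℓ * inner ℝ (x - proxPt S F ℓ w x) d))) := by
    have hc : Continuous e := by
      have := D.continuous_proxPt hws
      fun_prop
    simpa [e] using (hc.tendsto 0).mono_left (nhdsWithin_le_nhds (s := Set.Ioi (0 : ℝ)))
  have hsum := tendsto_ereal_sum Finset.univ
    (fun i => EReal.Tendsto.const_mul (hasDirDeriv_dirDeriv (D.convexOn i) hx hz)
      (.inl (EReal.coe_ne_bot (w i))) (.inl (EReal.coe_ne_top (w i))))
    (fun i => coe_mul_ne_top_of_ne_top (hws.1 i) (dirDeriv_ne_top (D.convexOn i) hx hz))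
  have hlim := (EReal.continuousAt_add (.inl hsum.2) (.inr (EReal.coe_ne_top _))).tendsto.comp
    (hsum.1.prodMk_nhds (EReal.tendsto_coe.2 he))
  rw [sub_eq_add_neg, ← EReal.coe_neg] at ha
  filter_upwards [hlim.eventually (gt_mem_nhds ha), self_mem_nhdsWithin] with t hta ht
  refine lt_of_le_of_lt ?_ hta
  have ht0 : 0 < t := ht
  simp only [Function.comp_apply, ← EReal.coe_mul, ← ereal_coe_sum, ← EReal.coe_add]
  rw [EReal.coe_le_coe_iff, div_le_iff₀ ht0]
  have h1 := D.dualValue_sub_le hws (x + t • d) x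
  have h2 := D.merit_le_dualValue hws (x + t • d)
  have h3 := D.merit_eq_dualValue hw
  rw [add_sub_cancel_left, real_inner_smul_right, norm_smul, mul_pow, Real.norm_eq_abs,
    sq_abs] at h1
  have h4 : (∑ i, w i * ((F i (x + t • d) - F i x) / t)) * t =
      ∑ i, w i * (F i (x + t • d) - F i x) := by
    rw [Finset.sum_mul]
    refine Finset.sum_congr rfl fun i _ => ?_
    field_simp
  rw [add_mul, h4]
  simp only [e]
  linarith

/-- Lower half: the weights now vary with `t`. Finite directional derivatives bound all slopes of
the `F i` from below, and stability of Λ controls the resulting expression. -/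
theorem eventually_lt_slope_merit {x z : Eu n} (hx : x ∈ S) (hz : z ∈ S)
    (hfin : ∀ i, dirDeriv (F i) x (z - x) ≠ ⊥) {a : EReal}
    (ha : a < ⨅ w ∈ dualSolutions S F ℓ x, ((∑ i, (w i : EReal) * dirDeriv (F i) x (z - x)) -
      ((ℓ * inner ℝ (x - proxPt S F ℓ w x) (z - x) : ℝ) : EReal))) :
    ∀ᶠ t : ℝ in 𝓝[>] 0,
      a < (((merit S F ℓ (x + t • (z - x)) - merit S F ℓ x) / t : ℝ) : EReal) := by
  have hIoo : Set.Ioo (0 : ℝ) 1 ∈ 𝓝[>] (0 : ℝ) := Ioo_mem_nhdsGT one_pos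
  choose c hc using fun i =>
    (⟨_, (EReal.coe_toReal (dirDeriv_ne_top (D.convexOn i) hx hz) (hfin i)).symm⟩ :
      ∃ c : ℝ, dirDeriv (F i) x (z - x) = c)
  have hslope : ∀ i, ∀ t ∈ Set.Ioo (0 : ℝ) 1, c i * t ≤ F i (x + t • (z - x)) - F i x := by
    intro i t ht
    have := dirDeriv_le_slope (D.convexOn i) hx hz ht
    rwa [hc, EReal.coe_le_coe_iff, le_div_iff₀ ht.1] at this
  simp only [hc, ← EReal.coe_mul, ← ereal_coe_sum, ← EReal.coe_sub] at ha
  set d := z - x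
  -- Two real levels: `b` is the strict bound on Λ(x) that passes to nearby dual solutions, and the
  -- gap down to `b'` absorbs the quadratic remainder.
  obtain ⟨b, hab, hb⟩ := EReal.lt_iff_exists_real_btwn.1 ha
  obtain ⟨b', hab', hb'⟩ := EReal.lt_iff_exists_real_btwn.1 hab
  rw [EReal.coe_lt_coe_iff] at hb'
  let r : (Fin m → ℝ) → ℝ := fun w =>
    ℓ * inner ℝ (x - proxPt S F ℓ w x) d - ∑ i, w i * c i
  have hr : ContinuousOn r (stdSimplex ℝ (Fin m)) := by
    have := D.continuousOn_proxPt x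
    fun_prop
  have hrb : ∀ w ∈ dualSolutions S F ℓ x, r w < -b := by
    intro w hw
    have := EReal.coe_lt_coe_iff.1 (hb.trans_le (iInf₂_le w hw))
    simp only [r]
    linarith
  have hev := D.eventually_forall_dualSolutions_lt (tendsto_segment x d)
    (fun i => tendsto_comp_segment (D.convexOn i) (D.lsc i) hx hz) hr hrb
  have hlim : Tendsto (fun t : ℝ => b - ℓ / 2 * t * ‖d‖ ^ 2) (𝓝[>] 0) (𝓝 b) := by
    have hcont : Continuous fun t : ℝ => b - ℓ / 2 * t * ‖d‖ ^ 2 := by fun_prop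
    simpa using (hcont.tendsto 0).mono_left (nhdsWithin_le_nhds (s := Set.Ioi (0 : ℝ)))
  filter_upwards [hev, hlim.eventually (lt_mem_nhds hb'), hIoo] with t htv htb ht
  refine hab'.trans (EReal.coe_lt_coe_iff.2 (htb.trans_le ?_))
  obtain ⟨v, hv⟩ := D.dualSolutions_nonempty (x + t • d)
  have hvr := htv v hv
  have h1 := D.dualValue_sub_le hv.1 x (x + t • d)
  have h2 := D.merit_le_dualValue hv.1 x
  have h3 := D.merit_eq_dualValue hv
  rw [sub_add_cancel_left, inner_neg_right, real_inner_smul_right, norm_neg, norm_smul, mul_pow,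
    Real.norm_eq_abs, sq_abs] at h1
  have h4 : ∑ i, v i * (F i x - F i (x + t • d)) ≤ -((∑ i, v i * c i) * t) := by
    rw [Finset.sum_mul, ← Finset.sum_neg_distrib]
    refine Finset.sum_le_sum fun i _ => ?_
    linarith [mul_le_mul_of_nonneg_left (hslope i t ht) (hv.1.1 i)]
  rw [le_div_iff₀ ht.1]
  have h5 := mul_le_mul_of_nonneg_left hvr.le ht.1.le
  simp only [r] at h5
  linarith

theorem hasDirDeriv_merit {x z : Eu n} (hx : x ∈ S) (hz : z ∈ S)
    (h : (∀ i, dirDeriv (F i) x (z - x) ≠ ⊥) ∨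
      ∃ i, dirDeriv (F i) x (z - x) = ⊥ ∧ ∃ w ∈ dualSolutions S F ℓ x, 0 < w i) :
    HasDirDeriv (merit S F ℓ) x (z - x)
      (⨅ w ∈ dualSolutions S F ℓ x, ((∑ i, (w i : EReal) * dirDeriv (F i) x (z - x)) -
        ((ℓ * inner ℝ (x - proxPt S F ℓ w x) (z - x) : ℝ) : EReal))) := by
  refine tendsto_order.2 ⟨fun a ha => ?_, fun a ha => ?_⟩
  · rcases h with h | ⟨i, hi, w, hw, hwi⟩
    · exact D.eventually_lt_slope_merit hx hz h ha
    -- A positive weight on an infinite derivative makes the infimum ⊥, so the lower bound is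
    -- vacuous.
    · refine absurd (ha.trans_le (iInf₂_le w hw)) ?_
      have hsum : ∑ j, (w j : EReal) * dirDeriv (F j) x (z - x) = ⊥ := by
        rw [← Finset.add_sum_erase _ _ (Finset.mem_univ i), hi, EReal.coe_mul_bot_of_pos hwi,
          EReal.bot_add]
      rw [hsum, EReal.bot_sub]
      exact not_lt_bot
  · simp only [iInf_lt_iff] at ha
    obtain ⟨w, hw, hwa⟩ := ha
    exact D.eventually_slope_merit_lt hx hz hw hwa

/-! ### Continuous differentiability of the merit function -/

/-- A one-sided estimate suffices because exchanging the two points yields the other side. -/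
theorem eventually_merit_sub_le {x : Eu n} {w : Fin m → ℝ} (hx : x ∈ S)
    (hw : dualSolutions S F ℓ x = {w}) {g : Fin m → Eu n}
    (hg : ∀ i, HasStrictGradientWithin (F i) S (g i) x) {ε : ℝ} (hε : 0 < ε) :
    ∀ᶠ p : Eu n × Eu n in 𝓝[S ×ˢ S] (x, x), merit S F ℓ p.1 - merit S F ℓ p.2 -
      inner ℝ ((∑ i, w i • g i) - ℓ • (x - proxPt S F ℓ w x)) (p.1 - p.2) ≤
        ε * ‖p.1 - p.2‖ := by
  have hℓ := D.ell_pos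
  have hwx : w ∈ dualSolutions S F ℓ x := by rw [hw]; exact Set.mem_singleton w
  have hfst : Tendsto Prod.fst (𝓝[S ×ˢ S] (x, x)) (𝓝 x) :=
    (continuous_fst.tendsto (x, x)).mono_left nhdsWithin_le_nhds
  have hsnd : Tendsto Prod.snd (𝓝[S ×ˢ S] (x, x)) (𝓝 x) :=
    (continuous_snd.tendsto (x, x)).mono_left nhdsWithin_le_nhds
  -- Fixing the second point at `x` in the strict gradient condition gives continuity at `x`, which
  -- stability of Λ requires.
  have hFx : ∀ i, Tendsto (F i) (𝓝[S] x) (𝓝 (F i x)) := by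
    intro i
    have hpair : Tendsto (fun y => (y, x)) (𝓝[S] x) (𝓝[S ×ˢ S] (x, x)) :=
      tendsto_nhdsWithin_iff.2 ⟨(by fun_prop : Continuous fun y : Eu n => (y, x)).tendsto x
        |>.mono_left nhdsWithin_le_nhds,
        eventually_of_mem self_mem_nhdsWithin fun y hy => ⟨hy, hx⟩⟩
    have hid : Tendsto (fun y => y - x) (𝓝[S] x) (𝓝 0) := by
      simpa using ((by fun_prop : Continuous fun y : Eu n => y - x).tendsto x).mono_left
        (nhdsWithin_le_nhds (s := S))
    have h1 := ((hg i).comp_tendsto hpair).isBigO.trans_tendsto hid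
    have h2 : Tendsto (fun y => inner ℝ (g i) (y - x)) (𝓝[S] x) (𝓝 0) := by
      simpa using (tendsto_const_nhds (x := g i)).inner (𝕜 := ℝ) hid
    simpa [Function.comp_def] using (h1.add h2).add_const (F i x)
  have hsndS : Tendsto Prod.snd (𝓝[S ×ˢ S] (x, x)) (𝓝[S] x) :=
    tendsto_nhdsWithin_iff.2 ⟨hsnd, eventually_of_mem self_mem_nhdsWithin fun p hp => hp.2⟩
  -- `r` bounds the change in the candidate gradient when `w` is replaced by another weight; it
  -- vanishes at `w`.
  let r : (Fin m → ℝ) → ℝ := fun v =>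
    ‖∑ i, (v i - w i) • g i‖ + ℓ * ‖proxPt S F ℓ v x - proxPt S F ℓ w x‖
  have hr : ContinuousOn r (stdSimplex ℝ (Fin m)) := by
    have := D.continuousOn_proxPt x
    fun_prop
  have hev1 := D.eventually_forall_dualSolutions_lt (b := ε / 3) hsnd
    (fun i => (hFx i).comp hsndS) hr (by
      intro v hv
      rw [hw, Set.mem_singleton_iff] at hv
      subst hv
      simpa [r] using by positivity)
  have hev2 : ∀ᶠ p : Eu n × Eu n in 𝓝[S ×ˢ S] (x, x), ∀ i,
      ‖F i p.1 - F i p.2 - inner ℝ (g i) (p.1 - p.2)‖ ≤ ε / 3 * ‖p.1 - p.2‖ :=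
    eventually_all.2 fun i => (isLittleO_iff.1 (hg i)) (by positivity)
  -- The factor 2ℓ covers the shift of the base point from `x` and the equally small shift of its
  -- proximal point.
  have hev3 : ∀ᶠ p : Eu n × Eu n in 𝓝[S ×ˢ S] (x, x),
      2 * ℓ * ‖p.1 - x‖ + ℓ / 2 * ‖p.1 - p.2‖ < ε / 3 := by
    have hc : Continuous fun p : Eu n × Eu n => 2 * ℓ * ‖p.1 - x‖ + ℓ / 2 * ‖p.1 - p.2‖ := by
      fun_prop
    exact ((hc.tendsto (x, x)).mono_left nhdsWithin_le_nhds).eventually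
      (gt_mem_nhds (by simpa using hε))
  filter_upwards [hev1, hev2, hev3] with p hp1 hp2 hp3
  obtain ⟨y, z⟩ := p
  simp only at hp1 hp2 hp3 ⊢
  obtain ⟨v, hv⟩ := D.dualSolutions_nonempty z
  have hvr := hp1 v hv
  simp only [r] at hvr
  have h1 := D.dualValue_sub_le hv.1 y z
  have h2 := D.merit_le_dualValue hv.1 y
  have h3 := D.merit_eq_dualValue hv
  have h4 : ∑ i, v i * (F i y - F i z) ≤
      inner ℝ (∑ i, v i • g i) (y - z) + ε / 3 * ‖y - z‖ := by
    calc ∑ i, v i * (F i y - F i z)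
        ≤ ∑ i, v i * (inner ℝ (g i) (y - z) + ε / 3 * ‖y - z‖) :=
          Finset.sum_le_sum fun i _ => mul_le_mul_of_nonneg_left
            (by linarith [(le_abs_self _).trans (hp2 i)]) (hv.1.1 i)
      _ = _ := by
          simp only [mul_add, Finset.sum_add_distrib, ← Finset.sum_mul, hv.1.2, one_mul,
            sum_inner, real_inner_smul_left]
  set P := proxPt S F ℓ v y
  set Q := proxPt S F ℓ w x
  have h5 : inner ℝ (∑ i, v i • g i) (y - z) - ℓ * inner ℝ (y - P) (y - z) =
      inner ℝ ((∑ i, w i • g i) - ℓ • (x - Q)) (y - z) +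
        inner ℝ ((∑ i, (v i - w i) • g i) - ℓ • ((y - x) - (P - Q))) (y - z) := by
    rw [← real_inner_smul_left, ← inner_sub_left, ← inner_add_left]
    congr 1
    simp only [sub_smul, Finset.sum_sub_distrib]
    module
  have h6 := real_inner_le_norm ((∑ i, (v i - w i) • g i) - ℓ • ((y - x) - (P - Q))) (y - z)
  have h7 : ‖(∑ i, (v i - w i) • g i) - ℓ • ((y - x) - (P - Q))‖ ≤
      ε / 3 + 2 * ℓ * ‖y - x‖ := by
    have h8 : ‖(y - x) - (P - Q)‖ ≤ 2 * ‖y - x‖ + ‖proxPt S F ℓ v x - Q‖ := by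
      have e : (y - x) - (P - Q) = (y - x) - (P - proxPt S F ℓ v x) -
          (proxPt S F ℓ v x - Q) := by abel
      rw [e]
      refine (norm_sub_le _ _).trans (add_le_add ((norm_sub_le _ _).trans ?_) le_rfl)
      linarith [D.norm_proxPt_sub_le hv.1 y x]
    refine (norm_sub_le _ _).trans ?_
    rw [norm_smul, Real.norm_of_nonneg hℓ.le]
    linarith [mul_le_mul_of_nonneg_left h8 hℓ.le]
  have h9 := h6.trans (mul_le_mul_of_nonneg_right h7 (norm_nonneg _))
  have h10 := mul_le_mul_of_nonneg_right hp3.le (norm_nonneg (y - z))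
  linarith

theorem hasStrictGradientWithin_merit {x : Eu n} {w : Fin m → ℝ} (hx : x ∈ S)
    (hw : dualSolutions S F ℓ x = {w}) {g : Fin m → Eu n}
    (hg : ∀ i, HasStrictGradientWithin (F i) S (g i) x) :
    HasStrictGradientWithin (merit S F ℓ) S
      ((∑ i, w i • g i) - ℓ • (x - proxPt S F ℓ w x)) x := by
  refine isLittleO_iff.2 fun ε hε => ?_
  have hev := D.eventually_merit_sub_le hx hw hg hε
  have hswap : Tendsto Prod.swap (𝓝[S ×ˢ S] (x, x)) (𝓝[S ×ˢ S] (x, x)) :=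
    tendsto_nhdsWithin_iff.2 ⟨(continuous_swap.tendsto (x, x)).mono_left nhdsWithin_le_nhds,
      eventually_of_mem self_mem_nhdsWithin fun p hp => ⟨hp.2, hp.1⟩⟩
  filter_upwards [hev, hswap.eventually hev] with p hp1 hp2
  simp only [Prod.fst_swap, Prod.snd_swap] at hp2
  rw [← neg_sub p.1 p.2, inner_neg_right, norm_neg] at hp2
  rw [Real.norm_eq_abs, abs_le]
  constructor <;> linarith

end ConvexData

end MultiMerit

/-- A function that is strictly differentiable at every point of an open set is `C¹` there. -/
theorem contDiffOn_one_of_hasStrictFDerivAt {E G : Type*} [NormedAddCommGroup E]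
    [NormedSpace ℝ E] [NormedAddCommGroup G] [NormedSpace ℝ G] {f : E → G} {f' : E → E →L[ℝ] G}
    {V : Set E} (hV : IsOpen V) (hf : ∀ x ∈ V, HasStrictFDerivAt f (f' x) x) :
    ContDiffOn ℝ 1 f V := by
  have hfd : ∀ x ∈ V, fderiv ℝ f x = f' x := fun x hx => (hf x hx).hasFDerivAt.fderiv
  rw [show (1 : WithTop ℕ∞) = 0 + 1 by simp, contDiffOn_succ_iff_fderiv_of_isOpen hV]
  refine ⟨fun x hx => (hf x hx).differentiableAt.differentiableWithinAt, by simp,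
    contDiffOn_zero.2 fun x hx => ContinuousAt.continuousWithinAt ?_⟩
  rw [ContinuousAt, tendsto_iff_norm_sub_tendsto_zero]
  refine Metric.tendsto_nhds.2 fun ε hε => ?_
  -- Subtracting the derivative at `x` leaves strict derivative zero, hence a small Lipschitz
  -- constant near `x`, which bounds the derivative at nearby points.
  have hstrict : HasStrictFDerivAt (fun y => f y - f' x y) (f' x - f' x) x :=
    (hf x hx).sub (f' x).hasStrictFDerivAt
  obtain ⟨s, hs, hlip⟩ := hstrict.exists_lipschitzOnWith_of_nnnorm_lt ⟨ε / 2, by positivity⟩ (by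
    rw [sub_self, nnnorm_zero]
    exact NNReal.coe_pos.1 (half_pos hε))
  filter_upwards [eventually_mem_nhds_iff.2 hs, hV.mem_nhds hx] with y hys hyV
  have hy : HasFDerivAt (fun y => f y - f' x y) (f' y - f' x) y :=
    (hf y hyV).hasFDerivAt.sub (f' x).hasFDerivAt
  have hle : ‖f' y - f' x‖ ≤ ε / 2 := hy.le_of_lipschitzOn hys hlip
  rw [dist_zero_right, norm_norm, hfd y hyV, hfd x hx]
  linarith

end

theorem mainTheorem5 {m n : ℕ} (hm : 1 ≤ m) (S : Set (MultiMerit.Eu n))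
    (hS_ne : S.Nonempty) (hS_closed : IsClosed S) (hS_convex : Convex ℝ S)
    (F : Fin m → MultiMerit.Eu n → ℝ)
    (hF_convex : ∀ i, ConvexOn ℝ S (F i))
    (hF_lsc : ∀ i, LowerSemicontinuousOn (F i) S)
    (ℓ : ℝ) (hℓ : 0 < ℓ) :
    -- the objects in the formulas are well defined
    (∀ x ∈ S,
      IsGreatest (MultiMerit.innerMin F ℓ x '' S) (MultiMerit.merit S F ℓ x) ∧
      (MultiMerit.dualSolutions S F ℓ x).Nonempty ∧
      ∀ w ∈ stdSimplex ℝ (Fin m), ∀ p : MultiMerit.Eu n,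
        MultiMerit.IsProx (MultiMerit.scalarized S F ℓ w) x p ↔
          p = MultiMerit.prox (MultiMerit.scalarized S F ℓ w) x) ∧
    -- directional differentiability
    (∀ x ∈ S, ∀ z ∈ S,
      (∀ i, MultiMerit.HasDirDeriv (F i) x (z - x) (MultiMerit.dirDeriv (F i) x (z - x)) ∧
        MultiMerit.dirDeriv (F i) x (z - x) ≠ ⊤) ∧
      (((∀ i, MultiMerit.dirDeriv (F i) x (z - x) ≠ ⊥) ∨
          (∃ i, MultiMerit.dirDeriv (F i) x (z - x) = ⊥ ∧
            ∃ w ∈ MultiMerit.dualSolutions S F ℓ x, 0 < w i)) →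
        MultiMerit.HasDirDeriv (MultiMerit.merit S F ℓ) x (z - x)
          (⨅ w ∈ MultiMerit.dualSolutions S F ℓ x,
            ((∑ i, (w i : EReal) * MultiMerit.dirDeriv (F i) x (z - x)) -
              ((ℓ * inner ℝ (x - MultiMerit.prox (MultiMerit.scalarized S F ℓ w) x)
                (z - x) : ℝ) : EReal))))) ∧
    -- continuous differentiability at a point
    (∀ x ∈ S, ∀ w : Fin m → ℝ, MultiMerit.dualSolutions S F ℓ x = {w} →
      ∀ g : Fin m → MultiMerit.Eu n,
        (∀ i, MultiMerit.HasStrictGradientWithin (F i) S (g i) x) →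
        MultiMerit.HasStrictGradientWithin (MultiMerit.merit S F ℓ) S
          ((∑ i, w i • g i) -
            ℓ • (x - MultiMerit.prox (MultiMerit.scalarized S F ℓ w) x)) x) ∧
    -- continuous differentiability on an open set
    (∀ V : Set (MultiMerit.Eu n), IsOpen V → V ⊆ S →
      (∀ i, ContDiffOn ℝ 1 (F i) V) →
      (∀ x ∈ V, ∃ w, MultiMerit.dualSolutions S F ℓ x = {w}) →
      ContDiffOn ℝ 1 (MultiMerit.merit S F ℓ) V ∧
      ∀ x ∈ V, ∀ w ∈ MultiMerit.dualSolutions S F ℓ x,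
        HasGradientAt (MultiMerit.merit S F ℓ)
          ((∑ i, w i • gradient (F i) x) -
            ℓ • (x - MultiMerit.prox (MultiMerit.scalarized S F ℓ w) x)) x) := by
  have D : MultiMerit.ConvexData S F ℓ := ⟨hm, hS_ne, hS_closed, hF_convex, hF_lsc, hℓ⟩
  refine ⟨fun x _ => ⟨D.isGreatest_merit x, D.dualSolutions_nonempty x,
    fun w hw p => D.isProx_iff hw x p⟩, fun x hx z hz =>
    ⟨fun i => ⟨MultiMerit.hasDirDeriv_dirDeriv (hF_convex i) hx hz,
      MultiMerit.dirDeriv_ne_top (hF_convex i) hx hz⟩, D.hasDirDeriv_merit hx hz⟩,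
    fun x hx w hw g hg => D.hasStrictGradientWithin_merit hx hw hg, fun V hV hVS hC hΛ => ?_⟩
  choose! w hw using hΛ
  have hstrict : ∀ x ∈ V, HasStrictFDerivAt (MultiMerit.merit S F ℓ)
      (InnerProductSpace.toDual ℝ (MultiMerit.Eu n) ((∑ i, w x i • gradient (F i) x) -
        ℓ • (x - MultiMerit.prox (MultiMerit.scalarized S F ℓ (w x)) x))) x := by
    intro x hx
    have hint : x ∈ interior S := interior_mono hVS (by rwa [hV.interior_eq])
    refine (MultiMerit.hasStrictGradientWithin_iff_of_mem_interior hint).1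
      (D.hasStrictGradientWithin_merit (hVS hx) (hw x hx) fun i => ?_)
    rw [MultiMerit.hasStrictGradientWithin_iff_of_mem_interior hint, gradient,
      LinearIsometryEquiv.apply_symm_apply]
    exact ((hC i).contDiffAt (hV.mem_nhds hx)).hasStrictFDerivAt one_ne_zero
  refine ⟨contDiffOn_one_of_hasStrictFDerivAt hV hstrict, fun x hx v hv => ?_⟩
  rw [hw x hx, Set.mem_singleton_iff] at hv
  subst hv
  exact hasGradientAt_iff_hasFDerivAt.2 (hstrict x hx).hasFDerivAt
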